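/- Let $d,m,k$ be natural numbers with $k\ge 2$, and write $\sigma_i(X)$ for the $i$-th largest singular value of a real matrix $X$ (with $\sigma_i(X)=0$ if $i$ exceeds the number of rows or of columns), $\sigma_{\max}(X)$ and $\sigma_{\min}(X)$ for its largest and smallest singular values (so $\sigma_{\min}(X)=\sigma_{\min\{p,q\}}(X)$ for $X\in\mathbb{R}^{p\times q}$), $\kappa(X)=\sigma_{\max}(X)/\sigma_{\min}(X)$, and $\|X\|_2$ for the spectral norm. Let $A=M+N$ with $M,N\in\mathbb{R}^{d\times m}$. Suppose that $M=FW$, where $F\in\mathbb{R}^{d\times k}$ has rank $k$ and $W=[I,H]\,\Pi\in\mathbb{R}^{k\times m}$ is entrywise nonnegative; here $I$ is the $k\times k$ identity, $\Pi$ is an $m\times m$ permutation matrix, and each column of $H\in\mathbb{R}^{k\times(m-k)}$ has entries summing to at most $1$. Suppose also that $$\|N\|_2<\min\Bigl\{\frac{1}{2\sqrt{k-1}},\frac14\Bigr\}\,\frac{\sigma_{\min}(F)}{1+80\,\kappa(F)^2}.$$ The successive projection algorithm (SPA) on input $(A,k)$ starts with $S=A$ and $\mathcal I=\emptyset$ and,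 as long as $|\mathcal I|<k$, chooses an index $i^*$ of a column of $S$ of largest Euclidean norm (ties broken arbitrarily), puts $t=s_{i^*}$, and replaces $S$ by $\bigl(I-tt^\top/\|t\|_2^2\bigr)S$ and $\mathcal I$ by $\mathcal I\cup\{i^*\}$; when $|\mathcal I|=k$ it returns $\mathcal I$. Then SPA on input $(A,k)$ has an output, and every possible output $\mathcal I$ satisfies $$\rho:=\sigma_{\min}(A(\mathcal I))-\sigma_{k+1}(A)>\frac{323-81\sqrt5}{324}\,\sigma_{\min}(F)>0,$$ where $A(\mathcal I)$ is the submatrix of $A$ formed by the columns with index in $\mathcal I$. -/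

import Mathlib

open scoped Matrix.Norms.L2Operator

noncomputable section

namespace SPA

/-- The `(i+1)`-th largest singular value of a real matrix (so `singVal X 0` is the largest one);
it is `0` when `i` is at least the number of rows or the number of columns. -/
def singVal {a b : Type*} [Fintype a] [Fintype b] [DecidableEq b] (X : Matrix a b ℝ) (i : ℕ) : ℝ :=
  (Matrix.toLpLin 2 2 X).singularValues i

/-- The largest singular value. -/
def sigmaMax {a b : Type*} [Fintype a] [Fintype b] [DecidableEq b] (X : Matrix a b ℝ) : ℝ :=
  singVal X 0

/-- The smallest singular value: the `t`-th largest one for an `a × b` matrix, where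
`t = min a b`. -/
def sigmaMin {a b : Type*} [Fintype a] [Fintype b] [DecidableEq b] (X : Matrix a b ℝ) : ℝ :=
  singVal X (min (Fintype.card a) (Fintype.card b) - 1)

/-- The condition number `σ_max / σ_min`. -/
def cond {a b : Type*} [Fintype a] [Fintype b] [DecidableEq b] (X : Matrix a b ℝ) : ℝ :=
  sigmaMax X / sigmaMin X

/-- `M = F W` with `W = [I, H] Π` entrywise nonnegative, `F` of full column rank, and every column
sum of `H` at most one. The permutation `Π` of the `m` columns is given as the bijection `π` from
the columns of the block matrix `[I, H]` to the columns of `W`. -/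
def IsSeparableWithBasis {d m k : ℕ} (M : Matrix (Fin d) (Fin m) ℝ)
    (F : Matrix (Fin d) (Fin k) ℝ) : Prop :=
  F.rank = k ∧
  ∃ (H : Matrix (Fin k) (Fin (m - k)) ℝ) (π : Fin k ⊕ Fin (m - k) ≃ Fin m)
    (W : Matrix (Fin k) (Fin m) ℝ),
    W = (Matrix.fromCols (1 : Matrix (Fin k) (Fin k) ℝ) H).submatrix id π.symm ∧
    (∀ i j, 0 ≤ W i j) ∧
    (∀ j, ∑ i, H i j ≤ 1) ∧
    M = F * W

/-- The squared Euclidean norm of the `i`-th column. -/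
def colSq {d m : ℕ} (S : Matrix (Fin d) (Fin m) ℝ) (i : Fin m) : ℝ :=
  ∑ r, S r i ^ 2

/-- The update `S ← (I - t tᵀ / ‖t‖²) S` where `t` is the `i`-th column of `S`.
(If `t` is a column of largest norm and `t = 0`, then `S = 0` and the update leaves `S = 0`.) -/
def projectOut {d m : ℕ} (S : Matrix (Fin d) (Fin m) ℝ) (i : Fin m) :
    Matrix (Fin d) (Fin m) ℝ :=
  (1 - (colSq S i)⁻¹ • Matrix.vecMulVec (S.col i) (S.col i)) * S

/-- The states `(S, I)` that the successive projection algorithm can reach on input `(A, k)`.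
Ties in the choice of a column of largest norm may be broken arbitrarily. -/
inductive Reachable {d m : ℕ} (A : Matrix (Fin d) (Fin m) ℝ) (k : ℕ) :
    Matrix (Fin d) (Fin m) ℝ → Finset (Fin m) → Prop
  | init : Reachable A k A ∅
  | step (S : Matrix (Fin d) (Fin m) ℝ) (I : Finset (Fin m)) (i : Fin m) :
      Reachable A k S I → I.card < k → (∀ j, colSq S j ≤ colSq S i) →
      Reachable A k (projectOut S i) (insert i I)

/-- `I` is a possible output of the successive projection algorithm on input `(A, k)`: the
algorithm can reach it, and it stops there because `|I|` is no longer below `k`. -/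
def IsOutput {d m : ℕ} (A : Matrix (Fin d) (Fin m) ℝ) (k : ℕ) (I : Finset (Fin m)) : Prop :=
  (∃ S, Reachable A k S I) ∧ ¬ I.card < k

/-- An output has exactly `k` elements. -/
theorem IsOutput.card_eq {d m k : ℕ} {A : Matrix (Fin d) (Fin m) ℝ} {I : Finset (Fin m)}
    (h : IsOutput A k I) : I.card = k := by
  obtain ⟨⟨S, hS⟩, hk⟩ := h
  refine le_antisymm ?_ (not_lt.mp hk)
  clear hk
  cases hS with
  | init => simp
  | step S I i _ hc _ => exact (Finset.card_insert_le i I).trans hc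

/-- On every input with `k ≤ m` there is an output. -/
theorem exists_isOutput {d m k : ℕ} (A : Matrix (Fin d) (Fin m) ℝ) (hkm : k ≤ m) :
    ∃ I, IsOutput A k I := by
  have key : ∀ n ≤ k, ∃ S I, Reachable A k S I ∧ I.card = n ∧ ∀ i ∈ I, ∀ r, S r i = 0 := by
    intro n
    induction n with
    | zero => exact fun _ => ⟨A, ∅, .init, rfl, by simp⟩
    | succ n ih =>
      intro hn
      obtain ⟨S, I, hR, hc, h0⟩ := ih (by omega)
      have hz : ∀ i, colSq S i = 0 ↔ ∀ r, S r i = 0 := by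
        intro i
        simp [colSq, Finset.sum_eq_zero_iff_of_nonneg, sq_nonneg]
      have hp : ∀ i, colSq S i ≠ 0 → ∀ r, projectOut S i r i = 0 := by
        intro i hi r
        have : projectOut S i r i = S r i - (colSq S i)⁻¹ * (S r i * colSq S i) := by
          simp [projectOut, Matrix.mul_apply, Matrix.vecMulVec_apply, colSq,
            Finset.mul_sum, pow_two, mul_assoc, sub_mul, Matrix.one_apply]
        rw [this]; field_simp; ring
      have hq : ∀ i j, (∀ r, S r j = 0) → ∀ r, projectOut S i r j = 0 := by
        intro i j hj r
        simp [projectOut, Matrix.mul_apply, hj]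
      have : ∃ i ∉ I, (∀ j, colSq S j ≤ colSq S i) ∧ ∀ r, projectOut S i r i = 0 := by
        by_cases hall : ∀ j, colSq S j = 0
        · obtain ⟨i, hi⟩ : ∃ i, i ∉ I := by
            by_contra! hne
            have := Finset.card_le_card (fun x _ => hne x : (Finset.univ : Finset (Fin m)) ⊆ I)
            simp at this
            omega
          exact ⟨i, hi, fun j => by rw [hall, hall], hq i i ((hz i).1 (hall i))⟩
        · push Not at hall
          obtain ⟨j, hj⟩ := hall
          obtain ⟨i, -, hi⟩ := Finset.exists_max_image Finset.univ (colSq S) ⟨j, by simp⟩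
          have hj0 : 0 ≤ colSq S j := Finset.sum_nonneg fun _ _ => sq_nonneg _
          have hi0 : colSq S i ≠ 0 := by
            have := hi j (by simp)
            intro h
            exact hj (le_antisymm (h ▸ this) hj0)
          exact ⟨i, fun hiI => hi0 ((hz i).2 (h0 i hiI)), fun j => hi j (by simp), hp i hi0⟩
      obtain ⟨i, hiI, hmax, hi0⟩ := this
      refine ⟨_, _, .step S I i hR (by omega) hmax, by simp [hiI, hc], ?_⟩
      intro j hj r
      rcases Finset.mem_insert.1 hj with rfl | hj
      · exact hi0 r
      · exact hq i j (h0 j hj) r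
  obtain ⟨S, I, hR, hc, -⟩ := key k le_rfl
  exact ⟨I, ⟨S, hR⟩, by omega⟩

/-- The submatrix `A(I)` of the columns of `A` with index in `I`. -/
def colSubmatrix {d m : ℕ} (A : Matrix (Fin d) (Fin m) ℝ) (I : Finset (Fin m)) :
    Matrix (Fin d) I ℝ :=
  A.submatrix id (fun i : I => (i : Fin m))

/-- `ρ = σ_min(A(I)) - σ_{k+1}(A)`. -/
def rho {d m : ℕ} (A : Matrix (Fin d) (Fin m) ℝ) (k : ℕ) (I : Finset (Fin m)) : ℝ :=
  sigmaMin (colSubmatrix A I) - singVal A k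

end SPA

end

/-!
Write `σ` and `κ` for the smallest singular value and the condition number of `F`, `ε = ‖N‖` and
`δ = ε (1 + 80 κ²)`. The selected columns `A(I)` turn out to be within `δ`, column by column, of
the columns of `F` in some order. Hence `σ_min(A(I)) ≥ σ - √k δ ≥ (1 - √5 / 4) σ`
(`SPA.sub_le_sigmaMin_colSubmatrix`, `sqrt_mul_min_le`), while Weyl's inequality for the matrix `M
= F W` of rank at most `k` gives `σ_{k+1}(A) ≤ ε < σ / 324` (`SPA.singVal_mul_add_le`). The
difference of the two bounds is the claim.

The columns are controlled by induction over the steps (`IsGoodSelection.insert_column`). Let `P`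
be the orthogonal projection onto the complement of the at most `k - 1` columns selected so far,
which approximate distinct columns of `F`. As `δ √(k - 1) ≤ σ / 2`, the projections of the
remaining columns of `F` still have smallest singular value at least `σ / 2`
(`half_mul_le_norm_residual`), so they are long and pairwise separated, while the projections of
the columns already approximated have norm at most `δ ≤ σ / 4`. The residual of each column of `A`
is, up to `ε`, a combination of these projections with nonnegative weights of sum at most one, and
every column of `F` occurs in `A` up to `ε`. A longest residual therefore nearly attains the
largest norm among these projections, and strong convexity of the squared norm forces its weight
`h` on a single remaining column to satisfy `1 - h ≤ 32 ε K / σ²`, with `K` the largest singular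
value of `F` (`exists_weight_close_to_one`). The weights are the same before projecting, so the
selected column of `A` is within `ε + 2 K (1 - h) ≤ ε + 64 ε κ² ≤ δ` of that column of `F`. The
bound does not involve the errors of earlier steps beyond `δ` itself, so the induction closes.
-/

/-! ### Singular values as bounds on norms -/

section SingularValues

open Module

variable {E F V : Type*} [NormedAddCommGroup E] [InnerProductSpace ℝ E] [FiniteDimensional ℝ E]
  [NormedAddCommGroup F] [InnerProductSpace ℝ F] [FiniteDimensional ℝ F]
  [AddCommGroup V] [Module ℝ V] [FiniteDimensional ℝ V]

/-- In an orthonormal basis of right singular vectors, `‖T v‖²` is diagonal with the squared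
singular values as weights. -/
theorem LinearMap.exists_orthonormalBasis_norm_sq (T : E →ₗ[ℝ] F) :
    ∃ b : OrthonormalBasis (Fin (finrank ℝ E)) ℝ E,
      ∀ v, ‖T v‖ ^ 2 = ∑ i : Fin (finrank ℝ E), T.singularValues i ^ 2 * b.repr v i ^ 2 := by
  have hT := T.isSymmetric_adjoint_comp_self
  refine ⟨hT.eigenvectorBasis rfl, fun v => ?_⟩
  have h : ‖T v‖ ^ 2 = inner ℝ ((adjoint T ∘ₗ T) v) v := by
    rw [LinearMap.comp_apply, LinearMap.adjoint_inner_left, real_inner_self_eq_norm_sq]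
  rw [h, ← (hT.eigenvectorBasis rfl).repr.inner_map_map, PiLp.inner_apply]
  refine Finset.sum_congr rfl fun i _ => ?_
  rw [hT.eigenvectorBasis_apply_self_apply rfl, T.sq_singularValues_fin rfl]
  simp only [RCLike.ofReal_real_eq_id, id_eq, RCLike.inner_apply, conj_trivial]
  ring

theorem LinearMap.norm_le_singularValues_zero_mul (T : E →ₗ[ℝ] F) (v : E) :
    ‖T v‖ ≤ T.singularValues 0 * ‖v‖ := by
  obtain ⟨b, hb⟩ := T.exists_orthonormalBasis_norm_sq
  refine le_of_sq_le_sq ?_ (mul_nonneg (T.singularValues_nonneg 0) (norm_nonneg v))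
  rw [hb, mul_pow, ← b.repr.norm_map v, EuclideanSpace.real_norm_sq_eq, Finset.mul_sum]
  gcongr with i
  · exact T.singularValues_nonneg i
  · exact T.singularValues_antitone (Nat.zero_le _)

theorem LinearMap.singularValues_mul_norm_le (T : E →ₗ[ℝ] F) {n : ℕ} (hn : finrank ℝ E ≤ n + 1)
    (v : E) : T.singularValues n * ‖v‖ ≤ ‖T v‖ := by
  obtain ⟨b, hb⟩ := T.exists_orthonormalBasis_norm_sq
  refine le_of_sq_le_sq ?_ (norm_nonneg _)
  rw [hb, mul_pow, ← b.repr.norm_map v, EuclideanSpace.real_norm_sq_eq, Finset.mul_sum]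
  gcongr with i
  · exact T.singularValues_nonneg n
  · exact T.singularValues_antitone (by omega)

theorem LinearMap.le_singularValues_of_forall_mul_norm_le (T : E →ₗ[ℝ] F) {c : ℝ}
    (h : ∀ v, c * ‖v‖ ≤ ‖T v‖) {n : ℕ} (hn : n < finrank ℝ E) : c ≤ T.singularValues n := by
  obtain ⟨b, hb⟩ := T.exists_orthonormalBasis_norm_sq
  have h1 : ‖T (b ⟨n, hn⟩)‖ = T.singularValues n := by
    rw [← sq_eq_sq₀ (norm_nonneg _) (T.singularValues_nonneg n), hb,
      Finset.sum_eq_single ⟨n, hn⟩] <;> simp +contextual [b.repr_self]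
  simpa [h1] using h (b ⟨n, hn⟩)

/-- The `(n+1)`-th singular value is at most the norm of the map on the kernel of any linear map
to a space of dimension at most `n`: this kernel meets the span of the first `n + 1` right singular
vectors. -/
theorem LinearMap.singularValues_le_of_forall_ker (T : E →ₗ[ℝ] F) (G : E →ₗ[ℝ] V) {n : ℕ}
    (hG : finrank ℝ V ≤ n) {c : ℝ} (hc : 0 ≤ c) (h : ∀ v, G v = 0 → ‖T v‖ ≤ c * ‖v‖) :
    T.singularValues n ≤ c := by
  by_cases hn : finrank ℝ E ≤ n
  · rwa [T.singularValues_of_finrank_le hn]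
  push Not at hn
  obtain ⟨b, hb⟩ := T.exists_orthonormalBasis_norm_sq
  let e : Fin (n + 1) → Fin (finrank ℝ E) := Fin.castLE hn
  let L : (Fin (n + 1) → ℝ) →ₗ[ℝ] E := Fintype.linearCombination ℝ (b ∘ e)
  obtain ⟨x, hx, hx0⟩ := Submodule.exists_mem_ne_zero_of_ne_bot
    (LinearMap.ker_ne_bot_of_finrank_lt (f := G ∘ₗ L) (by simp; omega))
  have hx' : L x ≠ 0 := fun h0 => hx0 <| by
    have hli := b.orthonormal.linearIndependent.comp e (Fin.castLE_injective hn)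
    exact funext (Fintype.linearIndependent_iff.1 hli x h0)
  have hrepr : ∀ i : Fin (finrank ℝ E), n < i → b.repr (L x) i = 0 := by
    intro i hi
    have : ∀ j, e j ≠ i := fun j hj => by
      have := congrArg Fin.val hj
      simp only [e, Fin.val_castLE] at this
      omega
    simp [L, Fintype.linearCombination_apply, fun j => (this j).symm]
  have hlow : T.singularValues n * ‖L x‖ ≤ ‖T (L x)‖ := by
    refine le_of_sq_le_sq ?_ (norm_nonneg _)
    rw [hb, mul_pow, ← b.repr.norm_map (L x), EuclideanSpace.real_norm_sq_eq, Finset.mul_sum]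
    refine Finset.sum_le_sum fun i _ => ?_
    by_cases hi : n < i
    · simp [hrepr i hi]
    · gcongr
      · exact T.singularValues_nonneg n
      · exact T.singularValues_antitone (by omega)
  exact le_of_mul_le_mul_right (hlow.trans (h _ hx)) (norm_pos_iff.2 hx')

end SingularValues

/-! ### Strong convexity and perturbed combinations -/

section PerturbedCombinations

variable {E : Type*} [NormedAddCommGroup E] [InnerProductSpace ℝ E]
  {ι J : Type*} [Fintype ι]

/-- Strong convexity of the squared norm as an exact identity: its defect on a weighted sum is a
weighted sum of the squared pairwise distances. -/
theorem norm_sq_sum_smul (h : ι → ℝ) (x : ι → E) :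
    2 * ‖∑ i, h i • x i‖ ^ 2 =
      2 * ((∑ i, h i) * ∑ i, h i * ‖x i‖ ^ 2) - ∑ i, ∑ j, h i * h j * ‖x i - x j‖ ^ 2 := by
  have h1 : ∀ i j, h i * h j * ‖x i - x j‖ ^ 2 =
      h j * (h i * ‖x i‖ ^ 2) + h i * (h j * ‖x j‖ ^ 2) - 2 * inner ℝ (h i • x i) (h j • x j) := by
    intro i j
    rw [norm_sub_sq_real, inner_smul_left, inner_smul_right, conj_trivial]
    ring
  have h2 : ‖∑ i, h i • x i‖ ^ 2 = ∑ i, ∑ j, inner ℝ (h i • x i) (h j • x j) := by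
    rw [← real_inner_self_eq_norm_sq, sum_inner]
    simp only [inner_sum]
  simp only [h1, Finset.sum_add_distrib, Finset.sum_sub_distrib, ← Finset.mul_sum,
    ← Finset.sum_mul, h2]
  ring

/-- The selection step. Let `y` be a combination, up to an error `ε`, of points `x i` in a ball of
radius `R`, with nonnegative weights of sum at most one. If `y` has norm at least `R - ε`, the
points with index outside `U` lie in the half-size ball, and those with index in `U` are
separated, then almost all the weight is on one point of `U`: by strong convexity, weight off `U`
or spread over several points of `U` costs norm. The bound does not involve the points outside
`U`, which is why errors do not accumulate over the steps of the algorithm. -/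
theorem exists_weight_close_to_one {h : ι → ℝ} {x : ι → E} {U : Finset ι} {y : E} {R τ ε : ℝ}
    (hh : ∀ i, 0 ≤ h i) (hsum : ∑ i, h i ≤ 1) (hτ : 0 < τ) (hτR : τ ≤ R)
    (hετ : 100 * ε ≤ τ) (hU : ∀ i ∈ U, ‖x i‖ ≤ R) (hU' : ∀ i ∉ U, ‖x i‖ ≤ R / 2)
    (hsep : ∀ i ∈ U, ∀ j ∈ U, i ≠ j → 2 * τ ^ 2 ≤ ‖x i - x j‖ ^ 2)
    (hy : ‖y - ∑ i, h i • x i‖ ≤ ε) (hyR : R - ε ≤ ‖y‖) :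
    ∃ i ∈ U, 1 - h i ≤ 8 * ε * R / τ ^ 2 := by
  classical
  have hR : 0 < R := hτ.trans_le hτR
  set s := ∑ i ∈ U, h i with hs
  have hsplit : ∑ i, h i = s + ∑ i ∈ Uᶜ, h i := (Finset.sum_add_sum_compl U h).symm
  have hz : R - 2 * ε ≤ ‖∑ i, h i • x i‖ := by
    have := norm_sub_norm_le y (∑ i, h i • x i)
    linarith
  have hs0 : 0 ≤ s := Finset.sum_nonneg fun i _ => hh i
  have hc0 : 0 ≤ ∑ i ∈ Uᶜ, h i := Finset.sum_nonneg fun i _ => hh i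
  have hs1 : s ≤ 1 := by linarith
  have hQ : ∑ i, h i * ‖x i‖ ^ 2 ≤ s * R ^ 2 + (1 - s) * (R / 2) ^ 2 := by
    rw [← Finset.sum_add_sum_compl U]
    have hc : ∑ i ∈ Uᶜ, h i ≤ 1 - s := by linarith
    refine add_le_add ?_ ((?_ : _ ≤ (∑ i ∈ Uᶜ, h i) * (R / 2) ^ 2).trans (by gcongr))
    · rw [hs, Finset.sum_mul]
      gcongr with i hi
      · exact hh i
      · exact hU i hi
    · rw [Finset.sum_mul]
      gcongr with i hi
      · exact hh i
      · exact hU' i (Finset.mem_compl.1 hi)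
  have hQ0 : 0 ≤ ∑ i, h i * ‖x i‖ ^ 2 :=
    Finset.sum_nonneg fun i _ => mul_nonneg (hh i) (sq_nonneg _)
  -- Among the squared distances, only those between distinct points of `U` are kept.
  have hD : 2 * τ ^ 2 * (s ^ 2 - ∑ i ∈ U, h i ^ 2) ≤ ∑ i, ∑ j, h i * h j * ‖x i - x j‖ ^ 2 := by
    have e1 : 2 * τ ^ 2 * (s ^ 2 - ∑ i ∈ U, h i ^ 2) =
        ∑ i ∈ U, ∑ j ∈ U, if i = j then 0 else h i * h j * (2 * τ ^ 2) := by
      have : ∀ i ∈ U, ∑ j ∈ U, (if i = j then 0 else h i * h j * (2 * τ ^ 2)) =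
          h i * s * (2 * τ ^ 2) - h i ^ 2 * (2 * τ ^ 2) := by
        intro i hi
        have : ∀ j, (if i = j then 0 else h i * h j * (2 * τ ^ 2)) =
            h i * h j * (2 * τ ^ 2) - if i = j then h i ^ 2 * (2 * τ ^ 2) else 0 := by
          intro j
          split_ifs with hij
          · subst hij; ring
          · ring
        simp only [this, Finset.sum_sub_distrib, Finset.sum_ite_eq, hi, if_true, hs,
          ← Finset.sum_mul, ← Finset.mul_sum]
      rw [Finset.sum_congr rfl this, Finset.sum_sub_distrib, ← Finset.sum_mul, ← Finset.sum_mul,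
        ← Finset.sum_mul]
      ring
    have hnn : ∀ i j, 0 ≤ h i * h j * ‖x i - x j‖ ^ 2 := fun i j =>
      mul_nonneg (mul_nonneg (hh i) (hh j)) (sq_nonneg _)
    rw [e1]
    calc _ ≤ ∑ i ∈ U, ∑ j ∈ U, h i * h j * ‖x i - x j‖ ^ 2 := by
          refine Finset.sum_le_sum fun i hi => Finset.sum_le_sum fun j hj => ?_
          split_ifs with hij
          · exact hnn i j
          · exact mul_le_mul_of_nonneg_left (hsep i hi j hj hij) (mul_nonneg (hh i) (hh j))
      _ ≤ ∑ i ∈ U, ∑ j, h i * h j * ‖x i - x j‖ ^ 2 := Finset.sum_le_sum fun i _ =>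
          Finset.sum_le_sum_of_subset_of_nonneg (Finset.subset_univ _) fun j _ _ => hnn i j
      _ ≤ _ := Finset.sum_le_sum_of_subset_of_nonneg (Finset.subset_univ _) fun i _ _ =>
          Finset.sum_nonneg fun j _ => hnn i j
  have hmain : 3 / 4 * R ^ 2 * (1 - s) + τ ^ 2 * (s ^ 2 - ∑ i ∈ U, h i ^ 2) ≤ 4 * ε * R := by
    have h1 := norm_sq_sum_smul h x
    have h2 : (∑ i, h i) * ∑ i, h i * ‖x i‖ ^ 2 ≤ ∑ i, h i * ‖x i‖ ^ 2 :=
      mul_le_of_le_one_left hQ0 hsum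
    have h3 : (R - 2 * ε) ^ 2 ≤ ‖∑ i, h i • x i‖ ^ 2 :=
      pow_le_pow_left₀ (by linarith) hz 2
    nlinarith [sq_nonneg ε]
  have hsq : ∑ i ∈ U, h i ^ 2 ≤ s ^ 2 := by
    rw [hs]
    exact Finset.sum_sq_le_sq_sum_of_nonneg fun i _ => hh i
  have hshalf : 1 / 2 ≤ s := by
    have h1 : 3 / 4 * R ^ 2 * (1 - s) ≤ 4 * ε * R := by nlinarith [sq_nonneg τ]
    have h2 : 3 / 4 * R * (1 - s) ≤ 4 * ε := by
      refine le_of_mul_le_mul_right ?_ hR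
      nlinarith
    nlinarith
  have hne : U.Nonempty := by
    by_contra hcon
    rw [Finset.not_nonempty_iff_eq_empty] at hcon
    simp [hs, hcon] at hshalf
    linarith
  -- The heaviest index works, because the sum of squares on `U` is at most `s` times its weight.
  obtain ⟨i, hi, hmax⟩ := Finset.exists_max_image U h hne
  refine ⟨i, hi, ?_⟩
  have hm : ∑ j ∈ U, h j ^ 2 ≤ s * h i := by
    rw [hs, Finset.sum_mul]
    refine Finset.sum_le_sum fun j hj => ?_
    rw [sq]
    exact mul_le_mul_of_nonneg_left (hmax j hj) (hh j)
  have his : h i ≤ s := Finset.single_le_sum (fun j _ => hh j) hi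
  rw [le_div_iff₀ (by positivity)]
  have hτ2 : τ ^ 2 ≤ R ^ 2 := pow_le_pow_left₀ hτ.le hτR 2
  have h1 : τ ^ 2 * (3 / 4 * (1 - s) + s * (s - h i)) ≤ 4 * ε * R := by
    have a1 := mul_le_mul_of_nonneg_right hτ2 (sub_nonneg.2 hs1)
    have a2 := mul_le_mul_of_nonneg_left hm (sq_nonneg τ)
    nlinarith
  have h2 : 1 - h i ≤ 2 * (3 / 4 * (1 - s) + s * (s - h i)) := by nlinarith
  have a3 := mul_le_mul_of_nonneg_right h2 (sq_nonneg τ)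
  linarith

/-- If the vectors `f i` have smallest singular value at least `σ`, replacing some of them by
vectors `a j` at distance at most `δ` lowers the norm of a combination with coefficients `c`, `b`
by at most `δ √|I| ‖b‖` from `σ ‖(c, b)‖`. -/
theorem lower_bound_of_close {f : ι → E} {a : J → E} {g : J → ι} {I : Finset J} {σ δ : ℝ}
    (hf : ∀ c : ι → ℝ, σ * √(∑ i, c i ^ 2) ≤ ‖∑ i, c i • f i‖)
    (hg : Set.InjOn g I) (hfa : ∀ j ∈ I, ‖a j - f (g j)‖ ≤ δ)
    (c : ι → ℝ) (hc : ∀ j ∈ I, c (g j) = 0) (b : J → ℝ) :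
    σ * √(∑ i, c i ^ 2 + ∑ j ∈ I, b j ^ 2) ≤
      ‖∑ i, c i • f i + ∑ j ∈ I, b j • a j‖ + δ * √I.card * √(∑ j ∈ I, b j ^ 2) := by
  classical
  -- `b` transported along `g`: the coefficients that the `b j` put on the vectors `f i`.
  let b' : ι → ℝ := fun i => ∑ j ∈ I, if g j = i then b j else 0
  have hb' : ∀ j ∈ I, b' (g j) = b j := by
    intro j hj
    have : ∀ j' ∈ I, (if g j' = g j then b j' else 0) = if j' = j then b j' else 0 := by
      intro j' hj'
      by_cases h : j' = j
      · simp [h]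
      · have : g j' ≠ g j := fun h' => h (hg hj' hj h')
        simp [h, this]
    simp only [b']
    rw [Finset.sum_congr rfl this]
    simp [hj]
  have hsum : ∑ i, c i • f i + ∑ j ∈ I, b j • f (g j) = ∑ i, (c i + b' i) • f i := by
    simp only [add_smul, Finset.sum_add_distrib, b', Finset.sum_smul, ite_smul, zero_smul]
    rw [Finset.sum_comm]
    simp
  have hsq : ∑ i, (c i + b' i) ^ 2 = ∑ i, c i ^ 2 + ∑ j ∈ I, b j ^ 2 := by
    have h1 : ∀ i, c i * b' i = 0 := by
      intro i
      simp only [b', Finset.mul_sum]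
      refine Finset.sum_eq_zero fun j hj => ?_
      split_ifs with h
      · rw [← h, hc j hj, zero_mul]
      · simp
    have h2 : ∑ i, b' i ^ 2 = ∑ j ∈ I, b j ^ 2 := by
      have : ∀ i, b' i ^ 2 = ∑ j ∈ I, if g j = i then b j ^ 2 else 0 := by
        intro i
        rw [sq]
        conv_lhs => rw [show b' i = ∑ j ∈ I, if g j = i then b j else 0 from rfl, Finset.sum_mul]
        refine Finset.sum_congr rfl fun j hj => ?_
        split_ifs with h
        · change b j * b' i = _
          rw [← h, hb' j hj, sq]
        · simp
      simp only [this]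
      rw [Finset.sum_comm]
      simp
    rw [← h2, ← Finset.sum_add_distrib]
    refine Finset.sum_congr rfl fun i _ => ?_
    linear_combination 2 * h1 i
  have herr : ‖∑ j ∈ I, b j • (a j - f (g j))‖ ≤ δ * √I.card * √(∑ j ∈ I, b j ^ 2) := by
    rcases I.eq_empty_or_nonempty with rfl | ⟨j0, hj0⟩
    · simp
    have hδ : 0 ≤ δ := (norm_nonneg _).trans (hfa j0 hj0)
    calc _ ≤ ∑ j ∈ I, |b j| * δ := by
          refine (norm_sum_le _ _).trans (Finset.sum_le_sum fun j hj => ?_)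
          rw [norm_smul, Real.norm_eq_abs]
          exact mul_le_mul_of_nonneg_left (hfa j hj) (abs_nonneg _)
      _ = δ * ∑ j ∈ I, |b j| := by rw [← Finset.sum_mul, mul_comm]
      _ ≤ δ * (√I.card * √(∑ j ∈ I, b j ^ 2)) := by
          refine mul_le_mul_of_nonneg_left ?_ hδ
          rw [← Real.sqrt_mul (Nat.cast_nonneg _)]
          refine Real.le_sqrt_of_sq_le ?_
          simpa using sq_sum_le_card_mul_sum_sq (s := I) (f := fun j => |b j|)
      _ = _ := by ring
  have key : ∑ i, (c i + b' i) • f i =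
      (∑ i, c i • f i + ∑ j ∈ I, b j • a j) - ∑ j ∈ I, b j • (a j - f (g j)) := by
    simp only [← hsum, smul_sub, Finset.sum_sub_distrib]
    abel
  rw [← hsq]
  refine (hf _).trans ?_
  rw [key]
  exact (norm_sub_le _ _).trans (by gcongr)

end PerturbedCombinations

/-! ### One step of successive projection in an inner product space -/

section SuccessiveProjection

variable {E : Type*} [NormedAddCommGroup E] [InnerProductSpace ℝ E]
  {ι J : Type*} [Fintype ι]

theorem norm_sum_smul_sub_le {f : ι → E} {K : ℝ} (hK : ∀ i, ‖f i‖ ≤ K) {h : ι → ℝ}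
    (hh : ∀ i, 0 ≤ h i) (hsum : ∑ i, h i ≤ 1) (i : ι) :
    ‖∑ l, h l • f l - f i‖ ≤ 2 * K * (1 - h i) := by
  classical
  have hK0 : 0 ≤ K := (norm_nonneg _).trans (hK i)
  rw [← Finset.add_sum_erase _ _ (Finset.mem_univ i)] at hsum
  have hi : h i ≤ 1 := by
    have : 0 ≤ ∑ l ∈ Finset.univ.erase i, h l := Finset.sum_nonneg fun l _ => hh l
    linarith
  have key : ∑ l, h l • f l - f i = ∑ l ∈ Finset.univ.erase i, h l • f l - (1 - h i) • f i := by
    rw [← Finset.add_sum_erase _ _ (Finset.mem_univ i), sub_smul, one_smul]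
    abel
  have h1 : ‖∑ l ∈ Finset.univ.erase i, h l • f l‖ ≤ (1 - h i) * K := by
    calc _ ≤ ∑ l ∈ Finset.univ.erase i, h l * K := by
          refine (norm_sum_le _ _).trans (Finset.sum_le_sum fun l _ => ?_)
          rw [norm_smul, Real.norm_of_nonneg (hh l)]
          exact mul_le_mul_of_nonneg_left (hK l) (hh l)
      _ = (∑ l ∈ Finset.univ.erase i, h l) * K := (Finset.sum_mul ..).symm
      _ ≤ _ := mul_le_mul_of_nonneg_right (by linarith) hK0
  have h2 : ‖(1 - h i) • f i‖ ≤ (1 - h i) * K := by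
    rw [norm_smul, Real.norm_of_nonneg (sub_nonneg.2 hi)]
    exact mul_le_mul_of_nonneg_left (hK i) (sub_nonneg.2 hi)
  rw [key]
  exact (norm_sub_le _ _).trans (by linarith)

/-- The state of the successive projection algorithm after selecting the columns `a j`, `j ∈ I`:
the linear map `P` takes the data to the residuals, and the selected columns are within `δ` of
distinct vectors `f i`. Of the fact that `P` is the orthogonal projection onto the complement of
the selected columns, only the three properties used are recorded. -/
structure IsGoodSelection (a : J → E) (f : ι → E) (δ : ℝ) (I : Finset J) (P : E →ₗ[ℝ] E) :
    Prop where
  exists_injOn : ∃ g : J → ι, Set.InjOn g I ∧ ∀ j ∈ I, ‖a j - f (g j)‖ ≤ δ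
  apply_eq_zero : ∀ j ∈ I, P (a j) = 0
  norm_apply_le : ∀ v, ‖P v‖ ≤ ‖v‖
  sub_apply_mem : ∀ v, v - P v ∈ Submodule.span ℝ (a '' I)

/-- The vectors `f i` not yet approximated stay well conditioned after the selected columns are
projected out: their residuals have smallest singular value at least `σ / 2`. -/
theorem half_mul_le_norm_residual {f : ι → E} {a : J → E} {g : J → ι} {I : Finset J} {σ δ : ℝ}
    {P : E →ₗ[ℝ] E} (hσ : 0 ≤ σ)
    (hf : ∀ c : ι → ℝ, σ * √(∑ i, c i ^ 2) ≤ ‖∑ i, c i • f i‖)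
    (hg : Set.InjOn g I) (hfa : ∀ j ∈ I, ‖a j - f (g j)‖ ≤ δ)
    (hP : ∀ v, v - P v ∈ Submodule.span ℝ (a '' I)) (hδ : δ * √I.card ≤ σ / 2)
    (c : ι → ℝ) (hc : ∀ j ∈ I, c (g j) = 0) :
    σ / 2 * √(∑ i, c i ^ 2) ≤ ‖P (∑ i, c i • f i)‖ := by
  classical
  obtain ⟨b, hbI, hb⟩ :=
    (Finsupp.mem_span_image_iff_linearCombination ℝ).1 (hP (∑ i, c i • f i))
  rw [Finsupp.linearCombination_apply_of_mem_supported ℝ hbI] at hb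
  have h := lower_bound_of_close hf hg hfa c hc fun j => -b j
  have e : ∑ i, c i • f i + ∑ j ∈ I, (-b j) • a j = P (∑ i, c i • f i) := by
    simp only [neg_smul, Finset.sum_neg_distrib, hb]
    exact (sub_eq_add_neg _ _).symm.trans (sub_sub_cancel _ _)
  rw [e] at h
  have hB : 0 ≤ ∑ j ∈ I, (-b j) ^ 2 := Finset.sum_nonneg fun _ _ => sq_nonneg _
  have hC : 0 ≤ ∑ i, c i ^ 2 := Finset.sum_nonneg fun _ _ => sq_nonneg _
  have h1 : √(∑ j ∈ I, (-b j) ^ 2) ≤ √(∑ i, c i ^ 2 + ∑ j ∈ I, (-b j) ^ 2) :=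
    Real.sqrt_le_sqrt (by linarith)
  have h2 : √(∑ i, c i ^ 2) ≤ √(∑ i, c i ^ 2 + ∑ j ∈ I, (-b j) ^ 2) :=
    Real.sqrt_le_sqrt (by linarith)
  have h3 := mul_le_mul hδ h1 (Real.sqrt_nonneg _) (by linarith)
  have h4 := mul_le_mul_of_nonneg_left h2 (by linarith : (0 : ℝ) ≤ σ / 2)
  linarith

/-- One step of the algorithm: a column `a j` of largest residual is within `δ` of a vector `f i`
that is not approximated by the columns selected before. -/
theorem IsGoodSelection.insert_column [DecidableEq J] {f : ι → E} {a : J → E} {I : Finset J}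
    {P : E →ₗ[ℝ] E} {σ δ ε K : ℝ} {w : J → ι → ℝ} {p : ι → J} {j : J}
    (hI : IsGoodSelection a f δ I P) (hcard : I.card < Fintype.card ι) (hσ : 0 < σ)
    (hf : ∀ c : ι → ℝ, σ * √(∑ i, c i ^ 2) ≤ ‖∑ i, c i • f i‖) (hK : ∀ i, ‖f i‖ ≤ K)
    (hw : ∀ j i, 0 ≤ w j i) (hwsum : ∀ j, ∑ i, w j i ≤ 1)
    (ha : ∀ j, ‖a j - ∑ i, w j i • f i‖ ≤ ε) (hp : ∀ i, ‖a (p i) - f i‖ ≤ ε)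
    (hε : 200 * ε ≤ σ) (hδ : δ * √I.card ≤ σ / 2) (hδ' : δ ≤ σ / 4)
    (hεδ : ε + 64 * ε * K ^ 2 / σ ^ 2 ≤ δ) (hj : ∀ j', ‖P (a j')‖ ≤ ‖P (a j)‖) :
    IsGoodSelection a f δ (insert j I)
      (((ℝ ∙ P (a j))ᗮ.starProjection : E →ₗ[ℝ] E) ∘ₗ P) := by
  classical
  obtain ⟨⟨g, hg, hfa⟩, hP0, hPn, hPs⟩ := hI
  have hε0 : 0 ≤ ε := (norm_nonneg _).trans (ha j)
  have hres := half_mul_le_norm_residual hσ.le hf hg hfa hPs hδ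
  -- The indices of the vectors that have not been approximated yet.
  set U : Finset ι := (I.image g)ᶜ with hUdef
  have hmemU : ∀ {i}, i ∈ U → ∀ j ∈ I, g j ≠ i := fun {i} hi j hj h =>
    (Finset.mem_compl.1 hi) (Finset.mem_image.2 ⟨j, hj, h⟩)
  have hUne : U.Nonempty := by
    rw [← Finset.card_pos, hUdef, Finset.card_compl]
    have := Finset.card_image_le (s := I) (f := g)
    omega
  obtain ⟨i₀, hi₀, hmax⟩ := Finset.exists_max_image U (fun i => ‖P (f i)‖) hUne
  have hlow : ∀ i ∈ U, σ / 2 ≤ ‖P (f i)‖ := by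
    intro i hi
    have := hres (Pi.single i 1) fun j hj => by simp [hmemU hi j hj]
    simpa [Pi.single_apply] using this
  have hsep : ∀ i ∈ U, ∀ l ∈ U, i ≠ l → 2 * (σ / 2) ^ 2 ≤ ‖P (f i) - P (f l)‖ ^ 2 := by
    intro i hi l hl hil
    have := hres (Pi.single i 1 - Pi.single l 1) fun j hj => by
      simp [hmemU hi j hj, hmemU hl j hj]
    have e1 : ∑ q, (Pi.single i 1 - Pi.single l 1 : ι → ℝ) q ^ 2 = 2 := by
      have : ∀ q, (Pi.single i 1 - Pi.single l 1 : ι → ℝ) q ^ 2 =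
          (if q = i then 1 else 0) + if q = l then 1 else 0 := by
        intro q
        by_cases h1 : q = i
        · subst h1; simp [hil]
        · by_cases h2 : q = l
          · subst h2; simp [h1]
          · simp [h1, h2]
      simp only [this, Finset.sum_add_distrib]
      simp
      norm_num
    have e2 : ∑ q, (Pi.single i 1 - Pi.single l 1 : ι → ℝ) q • f q = f i - f l := by
      simp [sub_smul, Finset.sum_sub_distrib, Pi.single_apply]
    rw [e1, e2, map_sub] at this
    calc 2 * (σ / 2) ^ 2 = (σ / 2 * √2) ^ 2 := by
          rw [mul_pow, Real.sq_sqrt (by norm_num)]; ring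
      _ ≤ _ := pow_le_pow_left₀ (by positivity) this 2
  have hR := hlow i₀ hi₀
  have hyR : ‖P (f i₀)‖ - ε ≤ ‖P (a j)‖ := by
    have h1 := norm_sub_norm_le (P (f i₀)) (P (a (p i₀)))
    rw [← map_sub] at h1
    have h2 := (hPn (f i₀ - a (p i₀))).trans ((norm_sub_rev _ _).trans_le (hp i₀))
    have h3 := hj (p i₀)
    linarith
  have hy : ‖P (a j) - ∑ i, w j i • P (f i)‖ ≤ ε := by
    have : P (a j) - ∑ i, w j i • P (f i) = P (a j - ∑ i, w j i • f i) := by simp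
    rw [this]
    exact (hPn _).trans (ha j)
  -- A vector already approximated by `a l` has a small residual, since `P` kills `a l`.
  have hU' : ∀ i ∉ U, ‖P (f i)‖ ≤ ‖P (f i₀)‖ / 2 := by
    intro i hi
    rw [hUdef, Finset.notMem_compl, Finset.mem_image] at hi
    obtain ⟨l, hl, rfl⟩ := hi
    have h1 : P (f (g l)) = -P (a l - f (g l)) := by simp [hP0 l hl]
    rw [h1, norm_neg]
    have := (hPn _).trans (hfa l hl)
    linarith
  obtain ⟨i, hi, hwi⟩ := exists_weight_close_to_one (x := fun i => P (f i)) (hw j) (hwsum j)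
    (half_pos hσ) hR (by linarith) hmax hU' hsep hy hyR
  have hjI : j ∉ I := fun h => by
    rw [hP0 j h, norm_zero] at hyR
    linarith
  -- The weights are those of `a j` itself, so the distance is measured before projecting.
  have hclose : ‖a j - f i‖ ≤ δ := by
    have hK0 : 0 ≤ K := (norm_nonneg _).trans (hK i)
    have h1 : ‖P (f i₀)‖ ≤ K := (hPn _).trans (hK i₀)
    have h2 : 2 * K * (1 - w j i) ≤ 64 * ε * K ^ 2 / σ ^ 2 :=
      calc 2 * K * (1 - w j i) ≤ 2 * K * (8 * ε * K / (σ / 2) ^ 2) := by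
            refine mul_le_mul_of_nonneg_left (hwi.trans ?_) (by positivity)
            gcongr
        _ = 64 * ε * K ^ 2 / σ ^ 2 := by field_simp; ring
    have h3 := norm_sum_smul_sub_le hK (hw j) (hwsum j) i
    have h4 := norm_sub_le_norm_sub_add_norm_sub (a j) (∑ l, w j l • f l) (f i)
    linarith [ha j]
  have hproj : ∀ v, (ℝ ∙ P (a j))ᗮ.starProjection v =
      v - (inner ℝ (P (a j)) v / ‖P (a j)‖ ^ 2) • P (a j) := by
    intro v
    rw [Submodule.starProjection_orthogonal_val, Submodule.starProjection_singleton]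
    rfl
  refine ⟨⟨Function.update g j i, ?_, ?_⟩, ?_, ?_, ?_⟩
  · rw [Finset.coe_insert, Set.injOn_insert (by simpa using hjI)]
    have heq : ∀ l ∈ I, Function.update g j i l = g l := fun l hl =>
      Function.update_of_ne ((ne_of_mem_of_not_mem hl hjI)) _ _
    refine ⟨hg.congr fun l hl => (heq l hl).symm, ?_⟩
    rintro ⟨l, hl, h⟩
    rw [heq l hl, Function.update_self] at h
    exact hmemU hi l hl h
  · intro l hl
    rcases Finset.mem_insert.1 hl with rfl | hl
    · rwa [Function.update_self]
    · rw [Function.update_of_ne (ne_of_mem_of_not_mem hl hjI)]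
      exact hfa l hl
  · intro l hl
    rcases Finset.mem_insert.1 hl with rfl | hl
    · exact Submodule.starProjection_orthogonal_apply_eq_zero
        (Submodule.mem_span_singleton_self (P (a l)))
    · simp [hP0 l hl]
  · intro v
    exact (Submodule.norm_starProjection_apply_le _ _).trans (hPn v)
  · intro v
    have hsub : Submodule.span ℝ (a '' I) ≤ Submodule.span ℝ (a '' (insert j I : Finset J)) :=
      Submodule.span_mono (Set.image_mono (by simp))
    have haj : P (a j) ∈ Submodule.span ℝ (a '' (insert j I : Finset J)) := by
      rw [← sub_sub_cancel (a j) (P (a j))]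
      exact sub_mem (Submodule.subset_span ⟨j, by simp, rfl⟩) (hsub (hPs _))
    have e : v - (((ℝ ∙ P (a j))ᗮ.starProjection : E →ₗ[ℝ] E) ∘ₗ P) v =
        (v - P v) + (inner ℝ (P (a j)) (P v) / ‖P (a j)‖ ^ 2) • P (a j) := by
      simp only [LinearMap.comp_apply, ContinuousLinearMap.coe_coe, hproj]
      abel
    rw [e]
    exact add_mem (hsub (hPs v)) (Submodule.smul_mem _ _ haj)

end SuccessiveProjection

/-! ### Columns of matrices -/

section MatrixColumns

variable {d n : Type*} [Fintype n]

theorem Matrix.toLpLin_two_eq_sum_col [DecidableEq n] (X : Matrix d n ℝ) (v : EuclideanSpace ℝ n) :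
    Matrix.toLpLin 2 2 X v = ∑ j, v j • WithLp.toLp 2 (X.col j) := by
  ext r
  simp [Matrix.toLpLin_apply, Matrix.mulVec, dotProduct, mul_comm]

theorem Matrix.norm_toLp_col_le [Fintype d] [DecidableEq n] (X : Matrix d n ℝ) (j : n) :
    ‖WithLp.toLp 2 (X.col j)‖ ≤ ‖X‖ := by
  simpa using X.l2_opNorm_mulVec (EuclideanSpace.single j (1 : ℝ))

theorem Matrix.toLp_mul_col {l : Type*} (X : Matrix d n ℝ) (W : Matrix n l ℝ) (j : l) :
    WithLp.toLp 2 ((X * W).col j) = ∑ i, W i j • WithLp.toLp 2 (X.col i) := by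
  ext r
  simp [Matrix.mul_apply, mul_comm]

end MatrixColumns

/-! ### The successive projection algorithm on a matrix -/

namespace SPA

theorem colSq_eq_norm_sq {d m : ℕ} (S : Matrix (Fin d) (Fin m) ℝ) (i : Fin m) :
    colSq S i = ‖WithLp.toLp 2 (S.col i)‖ ^ 2 := by
  simp [colSq, EuclideanSpace.real_norm_sq_eq]

/-- The update of the algorithm is the orthogonal projection onto the complement of the selected
column; both sides are the identity when that column is zero. -/
theorem projectOut_col {d m : ℕ} (S : Matrix (Fin d) (Fin m) ℝ) (i j : Fin m) :
    WithLp.toLp 2 ((projectOut S i).col j) =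
      (ℝ ∙ WithLp.toLp 2 (S.col i))ᗮ.starProjection (WithLp.toLp 2 (S.col j)) := by
  rw [Submodule.starProjection_orthogonal_val, Submodule.starProjection_singleton]
  have h : inner ℝ (WithLp.toLp 2 (S.col i)) (WithLp.toLp 2 (S.col j)) = ∑ r, S r i * S r j := by
    simp [PiLp.inner_apply, mul_comm]
  ext r
  simp only [RCLike.ofReal_real_eq_id, id_eq, h, ← colSq_eq_norm_sq]
  simp [projectOut, Matrix.sub_mul, Matrix.mul_apply, Matrix.vecMulVec_apply, div_eq_inv_mul,
    Finset.mul_sum, Finset.sum_mul]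
  exact Finset.sum_congr rfl fun _ _ => by ring

/-- Robustness of the successive projection algorithm: if the columns of `A` are, up to `ε`,
combinations of the vectors `f i` with the weights `w`, and each `f i` itself occurs up to `ε` as
the column `p i`, then at every reachable state the selected columns are within `δ` of distinct
vectors `f i`. -/
theorem Reachable.exists_isGoodSelection {d m k : ℕ} {A S : Matrix (Fin d) (Fin m) ℝ}
    {I : Finset (Fin m)} (hS : Reachable A k S I) {f : Fin k → EuclideanSpace ℝ (Fin d)}
    {σ δ ε K : ℝ} {w : Fin m → Fin k → ℝ} {p : Fin k → Fin m} (hk : 0 < k) (hσ : 0 < σ)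
    (hf : ∀ c : Fin k → ℝ, σ * √(∑ i, c i ^ 2) ≤ ‖∑ i, c i • f i‖) (hK : ∀ i, ‖f i‖ ≤ K)
    (hw : ∀ j i, 0 ≤ w j i) (hwsum : ∀ j, ∑ i, w j i ≤ 1)
    (ha : ∀ j, ‖WithLp.toLp 2 (A.col j) - ∑ i, w j i • f i‖ ≤ ε)
    (hp : ∀ i, ‖WithLp.toLp 2 (A.col (p i)) - f i‖ ≤ ε)
    (hε : 200 * ε ≤ σ) (hδ : δ * √((k : ℝ) - 1) ≤ σ / 2) (hδ0 : 0 ≤ δ) (hδ' : δ ≤ σ / 4)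
    (hεδ : ε + 64 * ε * K ^ 2 / σ ^ 2 ≤ δ) :
    ∃ P, IsGoodSelection (fun j => WithLp.toLp 2 (A.col j)) f δ I P ∧
      ∀ j, WithLp.toLp 2 (S.col j) = P (WithLp.toLp 2 (A.col j)) := by
  induction hS with
  | init =>
    refine ⟨LinearMap.id, ⟨?_, by simp, by simp, by simp⟩, by simp⟩
    exact ⟨fun _ => ⟨0, hk⟩, by simp, by simp⟩
  | step S I i _ hcard hmax ih =>
    obtain ⟨P, hP, hSP⟩ := ih
    have hk : (I.card : ℝ) ≤ (k : ℝ) - 1 := by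
      rw [le_sub_iff_add_le]
      exact_mod_cast hcard
    refine ⟨_, hP.insert_column (j := i) (by simpa using hcard) hσ hf hK hw hwsum ha hp hε
      ((mul_le_mul_of_nonneg_left (Real.sqrt_le_sqrt hk) hδ0).trans hδ) hδ' hεδ fun j => ?_,
      fun j => ?_⟩
    · rw [← hSP, ← hSP]
      have := hmax j
      rw [colSq_eq_norm_sq, colSq_eq_norm_sq] at this
      exact le_of_sq_le_sq this (norm_nonneg _)
    · rw [projectOut_col, hSP, hSP]
      rfl

theorem sub_le_sigmaMin_colSubmatrix {d m k : ℕ} {A : Matrix (Fin d) (Fin m) ℝ}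
    {I : Finset (Fin m)} {f : Fin k → EuclideanSpace ℝ (Fin d)} {σ δ : ℝ}
    {P : EuclideanSpace ℝ (Fin d) →ₗ[ℝ] EuclideanSpace ℝ (Fin d)} (hk : 0 < k) (hkd : k ≤ d)
    (hf : ∀ c : Fin k → ℝ, σ * √(∑ i, c i ^ 2) ≤ ‖∑ i, c i • f i‖)
    (hI : IsGoodSelection (fun j => WithLp.toLp 2 (A.col j)) f δ I P) (hcard : I.card = k) :
    σ - δ * √k ≤ sigmaMin (colSubmatrix A I) := by
  obtain ⟨g, hg, hga⟩ := hI.exists_injOn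
  rw [sigmaMin, singVal]
  refine LinearMap.le_singularValues_of_forall_mul_norm_le _ (fun v => ?_)
    (by have := hk; simp [hcard]; omega)
  have := lower_bound_of_close (I := (Finset.univ : Finset I)) (g := fun j : I => g j) hf
    (fun i _ j _ h => Subtype.ext (hg i.2 j.2 h)) (fun j _ => hga j j.2) 0 (by simp) v
  simp only [Pi.zero_apply, zero_smul, Finset.sum_const_zero, zero_add, ne_eq, OfNat.ofNat_ne_zero,
    not_false_eq_true, zero_pow, Finset.card_univ, Fintype.card_coe, hcard,
    ← EuclideanSpace.real_norm_sq_eq, Real.sqrt_sq (norm_nonneg v)] at this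
  rw [Matrix.toLpLin_two_eq_sum_col]
  have e : ∀ j : I, (colSubmatrix A I).col j = A.col j := fun j => rfl
  simp only [e]
  linarith

/-- Weyl's inequality for a perturbation of a matrix of rank at most `k`. -/
theorem singVal_mul_add_le {d m k : ℕ} {N : Matrix (Fin d) (Fin m) ℝ}
    {F : Matrix (Fin d) (Fin k) ℝ} {W : Matrix (Fin k) (Fin m) ℝ} :
    singVal (F * W + N) k ≤ ‖N‖ := by
  refine LinearMap.singularValues_le_of_forall_ker _ (Matrix.toLpLin 2 2 W) (by simp)
    (norm_nonneg _) fun v hv => ?_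
  rw [map_add, LinearMap.add_apply, Matrix.toLpLin_mul_same, LinearMap.comp_apply, hv, map_zero,
    zero_add, Matrix.toLpLin_apply]
  exact N.l2_opNorm_mulVec v

end SPA

/-- The two bounds cross at `k = 5`, where both sides are equal. -/
theorem sqrt_mul_min_le {k : ℝ} (hk : 2 ≤ k) :
    √k * min (1 / (2 * √(k - 1))) (1 / 4) ≤ √5 / 4 := by
  rcases le_total k 5 with h | h
  · calc √k * min (1 / (2 * √(k - 1))) (1 / 4) ≤ √5 * (1 / 4) := by
          gcongr
          exact min_le_right _ _
      _ = √5 / 4 := by ring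
  · have h1 : 0 < √(k - 1) := Real.sqrt_pos.2 (by linarith)
    have h2 : √k ≤ √5 / 2 * √(k - 1) := by
      refine Real.sqrt_le_iff.2 ⟨by positivity, ?_⟩
      rw [mul_pow, div_pow, Real.sq_sqrt (by norm_num), Real.sq_sqrt (by linarith)]
      linarith
    calc √k * min (1 / (2 * √(k - 1))) (1 / 4)
        ≤ (√5 / 2 * √(k - 1)) * (1 / (2 * √(k - 1))) := by
          gcongr
          exact min_le_left _ _
      _ = √5 / 4 := by field_simp; ring

theorem mainTheorem2 (d m k : ℕ) (hk : 2 ≤ k)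
    (A M N : Matrix (Fin d) (Fin m) ℝ) (F : Matrix (Fin d) (Fin k) ℝ)
    (hA : A = M + N) (hM : SPA.IsSeparableWithBasis M F)
    (hN : ‖N‖ < min (1 / (2 * √((k : ℝ) - 1))) (1 / 4) *
      (SPA.sigmaMin F / (1 + 80 * SPA.cond F ^ 2))) :
    (∃ I : Finset (Fin m), SPA.IsOutput A k I) ∧
    ∀ I : Finset (Fin m), SPA.IsOutput A k I →
      SPA.rho A k I > (323 - 81 * √5) / 324 * SPA.sigmaMin F ∧
      (323 - 81 * √5) / 324 * SPA.sigmaMin F > 0 := by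
  obtain ⟨hrank, H, π, W, hW, hW0, hH, rfl⟩ := hM
  have hkm : k ≤ m := by
    have := Fintype.card_congr π
    simp at this
    omega
  refine ⟨SPA.exists_isOutput A hkm, fun I hI => ?_⟩
  have hkd : k ≤ d := by simpa [hrank] using F.rank_le_height
  have hk' : (2 : ℝ) ≤ k := by exact_mod_cast hk
  set σ := SPA.sigmaMin F with hσdef
  set K := SPA.sigmaMax F with hKdef
  set ε := ‖N‖ with hεdef
  set μ := min (1 / (2 * √((k : ℝ) - 1))) (1 / 4) with hμdef
  have hcond : SPA.cond F = K / σ := rfl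
  rw [hcond] at hN
  set D := 1 + 80 * (K / σ) ^ 2 with hD
  have hD0 : 0 < D := by positivity
  have hμ0 : 0 ≤ μ := by positivity
  have hε0 : 0 ≤ ε := norm_nonneg _
  -- The noise bound would be nonpositive if `σ` were.
  have hσ : 0 < σ := by
    by_contra! h
    exact absurd (hε0.trans_lt hN)
      (not_lt.2 (mul_nonpos_of_nonneg_of_nonpos hμ0 (div_nonpos_of_nonpos_of_nonneg h hD0.le)))
  have hσK : σ ≤ K := (Matrix.toLpLin 2 2 F).singularValues_antitone (Nat.zero_le _)
  have hD81 : 81 ≤ D := by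
    have : 1 ≤ (K / σ) ^ 2 := one_le_pow₀ ((one_le_div hσ).2 hσK)
    linarith
  have hδμ : ε * D < μ * σ := by
    rwa [← mul_div_assoc, lt_div_iff₀ hD0] at hN
  have hμ4 : μ * σ ≤ σ / 4 := by
    have := mul_le_mul_of_nonneg_right (min_le_right _ _ : μ ≤ 1 / 4) hσ.le
    linarith
  -- As `ε * D < σ / 4` and `D ≥ 81`, the noise is below `σ / 324`.
  have hε324 : 324 * ε < σ := by nlinarith
  have hδk : ε * D * √((k : ℝ) - 1) ≤ σ / 2 := by
    have h1 : 0 < √((k : ℝ) - 1) := Real.sqrt_pos.2 (by linarith)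
    have h2 : μ ≤ 1 / (2 * √((k : ℝ) - 1)) := min_le_left _ _
    calc ε * D * √((k : ℝ) - 1) ≤ 1 / (2 * √((k : ℝ) - 1)) * σ * √((k : ℝ) - 1) := by
          exact mul_le_mul_of_nonneg_right (hδμ.le.trans (by gcongr)) h1.le
      _ = σ / 2 := by field_simp
  let f : Fin k → EuclideanSpace ℝ (Fin d) := fun i => WithLp.toLp 2 (F.col i)
  have hf : ∀ c : Fin k → ℝ, σ * √(∑ i, c i ^ 2) ≤ ‖∑ i, c i • f i‖ := by
    intro c
    have := (Matrix.toLpLin 2 2 F).singularValues_mul_norm_le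
      (n := min (Fintype.card (Fin d)) (Fintype.card (Fin k)) - 1) (by simp; omega)
      (WithLp.toLp 2 c)
    rw [Matrix.toLpLin_two_eq_sum_col, EuclideanSpace.norm_eq] at this
    simp only [Real.norm_eq_abs, sq_abs] at this
    exact this
  have hK : ∀ i, ‖f i‖ ≤ K := by
    intro i
    have := (Matrix.toLpLin 2 2 F).norm_le_singularValues_zero_mul (EuclideanSpace.single i 1)
    rw [PiLp.norm_single, norm_one, mul_one] at this
    have e : Matrix.toLpLin 2 2 F (EuclideanSpace.single i 1) = f i := by
      simp [Matrix.toLpLin_two_eq_sum_col, f]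
    rwa [e] at this
  have hAcol : ∀ j, WithLp.toLp 2 (A.col j) - ∑ i, W i j • f i = WithLp.toLp 2 (N.col j) := by
    intro j
    rw [← Matrix.toLp_mul_col, hA]
    ext r
    simp
  have hwsum : ∀ j, ∑ i, W i j ≤ 1 := by
    intro j
    obtain ⟨l | l, rfl⟩ := π.surjective j
    · simp [hW, Matrix.one_apply]
    · simpa [hW] using hH l
  have hp : ∀ i, ‖WithLp.toLp 2 (A.col (π (Sum.inl i))) - f i‖ ≤ ε := by
    intro i
    have : ∑ l, W l (π (Sum.inl i)) • f l = f i := by simp [hW, Matrix.one_apply]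
    rw [← this, hAcol]
    exact N.norm_toLp_col_le _
  obtain ⟨⟨S, hS⟩, -⟩ := id hI
  obtain ⟨P, hP, -⟩ := hS.exists_isGoodSelection (δ := ε * D) (w := fun j i => W i j)
    (by omega) hσ hf hK (fun j i => hW0 i j) hwsum
    (fun j => (hAcol j).symm ▸ N.norm_toLp_col_le j) hp (by linarith) hδk (by positivity)
    (by linarith) (by
      have : 0 ≤ ε * (K / σ) ^ 2 := by positivity
      have e : 64 * ε * K ^ 2 / σ ^ 2 = 64 * (ε * (K / σ) ^ 2) := by field_simp
      rw [e, hD]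
      linarith)
  have h1 := SPA.sub_le_sigmaMin_colSubmatrix (by omega) hkd hf hP hI.card_eq
  have h2 : SPA.singVal A k ≤ ε := hA ▸ SPA.singVal_mul_add_le
  have h3 : ε * D * √k ≤ √5 / 4 * σ :=
    calc ε * D * √k ≤ μ * σ * √k := by gcongr
      _ = √k * μ * σ := by ring
      _ ≤ √5 / 4 * σ := by
        gcongr
        exact sqrt_mul_min_le hk'
  have h5 : √5 < 3 := (Real.sqrt_lt' (by norm_num)).2 (by norm_num)
  refine ⟨?_, mul_pos (by linarith) hσ⟩
  rw [SPA.rho]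
  linarith
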